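/- Let $p$ be a prime, $s\ge 1$ and $n\ge 0$ integers, and $R=\mathbb{Z}/p^s\mathbb{Z}$. The Lee weight of $x\in R$, represented by an integer $0\le x<p^s$, is $\min\{x,p^s-x\}$, and the Lee weight of a vector in $R^n$ is the sum of the Lee weights of its entries. A linear code of length $n$ is an $R$-submodule $\mathcal{C}\subseteq R^n$; its subtype is the unique tuple $(k_0,\dots,k_{s-1})$ of nonnegative integers with $\mathcal{C}\cong\bigoplus_{i=0}^{s-1}(R/p^{s-i}R)^{k_i}$. Let $M_i$ be the maximum Lee weight of an element of the ideal $\langle p^i\rangle\subseteq R$. A linear code of subtype $(k_0,\dots,k_{s-1})$ is an optimal Lee-metric anticode if the maximum Lee weight of its codewords equals $\sum_{i=0}^{s-1}k_iM_i$. Two codes $\mathcal{C},\mathcal{D}\subseteq R^n$ are permutation equivalent if $\mathcal{D}=\mathcal{C}P$ for some $n\times n$ permutation matrix $P$. For nonnegative integers $k_0,\dots,k_{s-1}$ with $K=\sum_{i=0}^{s-1}k_i\le n$, let $A_{(k_0,\dots,k_{s-1},n-K)}\in R^{K\times n}$ be the matrix whose first $K$ columns form the block-diagonal matrix $\mathrm{diag}(I_{k_0},pI_{k_1},\dots,p^{s-1}I_{k_{s-1}})$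 and whose last $n-K$ columns are zero. Theorem. (1) If $k_0,\dots,k_{s-1}$ are nonnegative integers with $K\le n$ and $\mathcal{C}\subseteq R^n$ is a linear code permutation equivalent to the code generated by the rows of $A_{(k_0,\dots,k_{s-1},n-K)}$, then $\mathcal{C}$ is an optimal Lee-metric anticode. (2) Conversely, if $p\neq 2$ and $\mathcal{C}\subseteq R^n$ is an optimal Lee-metric anticode of subtype $(k_0,\dots,k_{s-1})$, then $K=\sum_{i=0}^{s-1} k_i\le n$ and $\mathcal{C}$ is permutation equivalent to the code generated by the rows of $A_{(k_0,\dots,k_{s-1},n-K)}$. -/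

import Mathlib

namespace LeeCode

/-- The Lee weight of a residue class modulo `m`: the minimum of `x` and `m - x`, where `x` is
identified with its representative in `{0, …, m - 1}`. -/
def leeWt {m : ℕ} (x : ZMod m) : ℕ := min x.val (m - x.val)

/-- The Lee weight of a vector is the sum of the Lee weights of its entries. -/
def leeWeight {m n : ℕ} (x : Fin n → ZMod m) : ℕ := ∑ j, leeWt (x j)

/-- A linear code of length `n` over `ℤ/p^s`: a submodule of `(ℤ/p^s)^n`. -/
abbrev Code (p s n : ℕ) := Submodule (ZMod (p ^ s)) (Fin n → ZMod (p ^ s))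

/-- The maximum Lee weight of a code. -/
noncomputable def maxLeeWeight {p s n : ℕ} (C : Code p s n) : ℕ :=
  sSup {w | ∃ c ∈ C, leeWeight c = w}

/-- `M_i`, the maximum Lee weight of an element of the ideal `⟨p^i⟩` of `ℤ/p^s`. -/
noncomputable def idealMaxLee (p s i : ℕ) : ℕ :=
  sSup {w | ∃ x ∈ Ideal.span {(p : ZMod (p ^ s)) ^ i}, leeWt x = w}

/-- The supremum defining `maxLeeWeight` is an attained maximum. -/
theorem isGreatest_maxLeeWeight {p s n : ℕ} [NeZero p] (C : Code p s n) :
    IsGreatest {w | ∃ c ∈ C, leeWeight c = w} (maxLeeWeight C) := by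
  have hfin : {w | ∃ c ∈ C, leeWeight c = w}.Finite :=
    (Set.toFinite (C : Set (Fin n → ZMod (p ^ s)))).image leeWeight
  exact ⟨Nat.sSup_mem ⟨_, 0, C.zero_mem, rfl⟩ hfin.bddAbove,
    fun _ hw => le_csSup hfin.bddAbove hw⟩

/-- The supremum defining `idealMaxLee` is an attained maximum. -/
theorem isGreatest_idealMaxLee (p s i : ℕ) [NeZero p] :
    IsGreatest {w | ∃ x ∈ Ideal.span {(p : ZMod (p ^ s)) ^ i}, leeWt x = w}
      (idealMaxLee p s i) := by
  have hfin : {w | ∃ x ∈ Ideal.span {(p : ZMod (p ^ s)) ^ i}, leeWt x = w}.Finite :=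
    (Set.toFinite (Ideal.span {(p : ZMod (p ^ s)) ^ i} : Set (ZMod (p ^ s)))).image leeWt
  exact ⟨Nat.sSup_mem ⟨_, 0, Ideal.zero_mem _, rfl⟩ hfin.bddAbove,
    fun _ hw => le_csSup hfin.bddAbove hw⟩

/-- The code `C` has subtype `(k_0, …, k_{s-1})`: with `R = ℤ/p^s`, it is isomorphic as an
`R`-module to the direct sum over `i` of `(R / p^(s-i) R)^(k_i)`. -/
def HasSubtype {p s n : ℕ} (C : Code p s n) (k : Fin s → ℕ) : Prop :=
  Nonempty (C ≃ₗ[ZMod (p ^ s)]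
    ((i : Fin s) → Fin (k i) →
      ZMod (p ^ s) ⧸ Ideal.span {(p : ZMod (p ^ s)) ^ (s - (i : ℕ))}))

/-- An optimal Lee-metric anticode: the maximum Lee weight equals `∑ k_i M_i`,
where `(k_0, …, k_{s-1})` is the subtype. -/
def IsOptimalLeeAnticode {p s n : ℕ} (C : Code p s n) : Prop :=
  ∃ k : Fin s → ℕ, HasSubtype C k ∧ maxLeeWeight C = ∑ i, k i * idealMaxLee p s i

/-- The `K × n` block matrix `diag(I_{k_0}, p I_{k_1}, …, p^{s-1} I_{k_{s-1}})` followed by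
`n - K` zero columns, where `K = ∑ k_i ≤ n`. The row `(i, a)` is the `a`-th row of the `i`-th
block; `finSigmaFinEquiv` lists these rows block after block. -/
def diagMatrix (p s n : ℕ) (k : Fin s → ℕ) :
    Matrix ((i : Fin s) × Fin (k i)) (Fin n) (ZMod (p ^ s)) :=
  Matrix.of fun r c =>
    if (finSigmaFinEquiv r : ℕ) = (c : ℕ) then (p : ZMod (p ^ s)) ^ (r.1 : ℕ) else 0

/-- The code generated by the rows of a matrix. -/
def rowCode {p s n : ℕ} {ι : Type*} (A : Matrix ι (Fin n) (ZMod (p ^ s))) : Code p s n :=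
  Submodule.span (ZMod (p ^ s)) (Set.range A.row)

/-- `C` and `D` are permutation equivalent: `D = C P` for a permutation matrix `P`. -/
def PermEquiv {p s n : ℕ} (C D : Code p s n) : Prop :=
  ∃ σ : Equiv.Perm (Fin n), D = C.map (σ.permMatrix (ZMod (p ^ s))).vecMulLinear

end LeeCode

/-!
The block diagonal code is the product of ideals `box p s e = ∏ⱼ ⟨p^(e j)⟩` with `e j` the exponent
of the `j`-th column (`rowCode_diagMatrix`), so a heaviest codeword is found coordinate by
coordinate and the code is optimal. This gives one direction for every prime.

For the converse let `p` be odd, so that `M_e = (p^s - p^e)/2` for `e ≤ s`. Every code `C` has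
leading exponents `e` (`IsLeading`): `⟨p^(e j)⟩` is the ideal of `j`-th coordinates of the codewords
that vanish before `j`. Two inequalities compare `∑ⱼ M_(e j)` with the two sides of the equation
that defines optimality.

* Choosing the coordinates greedily one after the other, one finds a codeword of Lee weight at least
  `∑ⱼ M_(e j)`, because every coset of `⟨p^i⟩` has an element of Lee weight at least `M_i`
  (`exists_le_leeWt_add`). Only the coset `⟨p^i⟩` itself has no heavier element, and it attains
  `M_i` at two elements that differ by `p^i`; comparing the two resulting choices shows that a sharp
  bound forces `C ≤ ∏ⱼ ⟨p^(e j)⟩` (`IsLeading.le_box_of_leeWeight_add_le`). Then equality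
  holds, since both sides have the same number of elements.
* If `C` has subtype `k`, then `∑ᵢ k_i M_i ≤ ∑ⱼ M_(e j)`. Indeed the length of the `p^m`-torsion of
  `C` is `∑ᵢ k_i min(m, s - i)`, and it is at most `∑ⱼ min(m, s - e j)`
  (`IsLeading.card_inf_const_le`). As `ℓ ↦ M_(s - ℓ)` is a nonnegative combination of the functions
  `ℓ ↦ min(m, ℓ)`, the inequality follows (`sum_idealMaxLee_le`).

So an optimal anticode equals `∏ⱼ ⟨p^(e j)⟩`. The sizes of its torsion submodules determine the
multiset of the exponents `e j`, hence identify it with the block diagonal code of its subtype up to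
a permutation of the coordinates (`permEquiv_of_hasSubtype_box`).
-/

namespace LeeCode

/-! ### Ideals of `ℤ/p^s` -/

section Ideals

variable {p s : ℕ}

theorem natCast_pow_self_eq_zero : (p : ZMod (p ^ s)) ^ s = 0 := by
  exact_mod_cast ZMod.natCast_self (p ^ s)

theorem span_pow_inf_span_pow (a b : ℕ) :
    (Ideal.span {(p : ZMod (p ^ s)) ^ a} ⊓ Ideal.span {(p : ZMod (p ^ s)) ^ b} :
      Ideal (ZMod (p ^ s))) = Ideal.span {(p : ZMod (p ^ s)) ^ max a b} := by
  have key {a b : ℕ} (h : a ≤ b) : (Ideal.span {(p : ZMod (p ^ s)) ^ b} :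
      Ideal (ZMod (p ^ s))) ≤ Ideal.span {(p : ZMod (p ^ s)) ^ a} :=
    Ideal.span_singleton_le_span_singleton.2 (pow_dvd_pow _ h)
  rcases le_total a b with h | h
  · rw [max_eq_right h, inf_eq_right.2 (key h)]
  · rw [max_eq_left h, inf_eq_left.2 (key h)]

variable [Fact p.Prime]

theorem natCast_mem_span_pow_iff {e : ℕ} (he : e ≤ s) (a : ℕ) :
    (a : ZMod (p ^ s)) ∈ Ideal.span {(p : ZMod (p ^ s)) ^ e} ↔ p ^ e ∣ a := by
  rw [Ideal.mem_span_singleton']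
  constructor
  · rintro ⟨y, hy⟩
    have h : ((y.val * p ^ e : ℕ) : ZMod (p ^ s)) = (a : ZMod (p ^ s)) := by
      push_cast
      rw [ZMod.natCast_zmod_val, hy]
    rw [ZMod.natCast_eq_natCast_iff] at h
    exact (h.of_dvd (pow_dvd_pow p he)).dvd_iff dvd_rfl |>.1 (Dvd.intro_left _ rfl)
  · rintro ⟨b, rfl⟩
    exact ⟨b, by push_cast; ring⟩

theorem mem_span_pow_iff {e : ℕ} (he : e ≤ s) (x : ZMod (p ^ s)) :
    x ∈ Ideal.span {(p : ZMod (p ^ s)) ^ e} ↔ p ^ e ∣ x.val := by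
  rw [← natCast_mem_span_pow_iff he, ZMod.natCast_zmod_val]

theorem pow_mul_eq_zero_iff (m : ℕ) (x : ZMod (p ^ s)) :
    (p : ZMod (p ^ s)) ^ m * x = 0 ↔ x ∈ Ideal.span {(p : ZMod (p ^ s)) ^ (s - m)} := by
  have hp : 0 < p := (Fact.out : p.Prime).pos
  rcases le_total m s with h | h
  · rw [mem_span_pow_iff (Nat.sub_le s m)]
    have : (p : ZMod (p ^ s)) ^ m * x = ((p ^ m * x.val : ℕ) : ZMod (p ^ s)) := by
      push_cast
      rw [ZMod.natCast_zmod_val]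
    rw [this, ZMod.natCast_eq_zero_iff]
    rw [← Nat.mul_dvd_mul_iff_left (pow_pos hp m) (b := p ^ (s - m)), ← pow_add,
      Nat.add_sub_cancel' h]
  · have h0 : (p : ZMod (p ^ s)) ^ m = 0 := pow_eq_zero_of_le h natCast_pow_self_eq_zero
    simp [Nat.sub_eq_zero_of_le h, h0]

theorem card_span_pow {e : ℕ} (he : e ≤ s) :
    Nat.card (Ideal.span {(p : ZMod (p ^ s)) ^ e} : Ideal (ZMod (p ^ s))) = p ^ (s - e) := by
  have hp : 0 < p := (Fact.out : p.Prime).pos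
  have h : (Ideal.span {(p : ZMod (p ^ s)) ^ e} : Set (ZMod (p ^ s))) =
      (AddSubgroup.zmultiples ((p ^ e : ℕ) : ZMod (p ^ s)) : Set (ZMod (p ^ s))) := by
    ext x
    simp only [SetLike.mem_coe, Ideal.mem_span_singleton', AddSubgroup.mem_zmultiples_iff]
    constructor
    · rintro ⟨a, rfl⟩
      exact ⟨a.val, by simp⟩
    · rintro ⟨a, rfl⟩
      exact ⟨a, by simp⟩
  calc _ = Nat.card (AddSubgroup.zmultiples ((p ^ e : ℕ) : ZMod (p ^ s))) :=
        Nat.card_congr (Equiv.setCongr h)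
    _ = _ := by
        rw [Nat.card_zmultiples, ZMod.addOrderOf_coe _ (pow_pos hp s).ne',
          Nat.gcd_eq_right (pow_dvd_pow p he), Nat.pow_div he hp]

theorem exists_eq_span_pow (I : Ideal (ZMod (p ^ s))) :
    ∃ e ≤ s, I = Ideal.span {(p : ZMod (p ^ s)) ^ e} := by
  obtain ⟨d, hd⟩ := IsPrincipalIdealRing.principal (I.comap (Int.castRingHom (ZMod (p ^ s))))
  have hI : I = Ideal.span {(d : ZMod (p ^ s))} := by
    rw [← Ideal.map_comap_of_surjective (Int.castRingHom (ZMod (p ^ s)))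
      (ZMod.ringHom_surjective _) I, hd]
    change Ideal.map _ (Ideal.span {d}) = _
    rw [Ideal.map_span]
    simp
  have hps : d ∣ (p : ℤ) ^ s := by
    rw [← Ideal.mem_span_singleton]
    change _ ∈ Submodule.span ℤ {d}
    rw [← hd, Ideal.mem_comap]
    simp [natCast_pow_self_eq_zero]
  obtain ⟨e, he, hde⟩ := (dvd_prime_pow (Nat.prime_iff_prime_int.1 Fact.out) s).1 hps
  refine ⟨e, he, hI.trans ?_⟩
  have h : Associated (d : ZMod (p ^ s)) (p ^ e) := by
    simpa using hde.map (Int.castRingHom (ZMod (p ^ s)))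
  exact le_antisymm (Ideal.span_singleton_le_span_singleton.2 h.symm.dvd)
    (Ideal.span_singleton_le_span_singleton.2 h.dvd)

end Ideals

/-! ### Lee weights in a coset of an ideal -/

section LeeWeight

theorem leeWt_natCast {m a : ℕ} (h : a < m) : leeWt (a : ZMod m) = min a (m - a) := by
  rw [leeWt, ZMod.val_cast_of_lt h]

variable {p s : ℕ} [Fact p.Prime]

theorem leeWt_le_idealMaxLee {e : ℕ} {x : ZMod (p ^ s)}
    (hx : x ∈ Ideal.span {(p : ZMod (p ^ s)) ^ e}) : leeWt x ≤ idealMaxLee p s e :=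
  (isGreatest_idealMaxLee p s e).2 ⟨x, hx, rfl⟩

theorem idealMaxLee_self : idealMaxLee p s s = 0 := by
  obtain ⟨x, hx, h⟩ := (isGreatest_idealMaxLee p s s).1
  rw [natCast_pow_self_eq_zero, Ideal.mem_span_singleton, zero_dvd_iff] at hx
  rw [← h, hx]
  simp [leeWt]

/-- The integer `M = (p^s - p^e)/2` is a multiple of `p^e` when `p` is odd. -/
theorem exists_two_mul_add_pow (hp : p ≠ 2) {e : ℕ} (he : e ≤ s) :
    ∃ b, 2 * (p ^ e * b) + p ^ e = p ^ s := by
  have hodd : Odd (p ^ (s - e)) := ((Fact.out : p.Prime).odd_of_ne_two hp).pow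
  obtain ⟨b, hb⟩ := hodd
  refine ⟨b, ?_⟩
  rw [← Nat.add_sub_cancel' he, pow_add, hb]
  ring

theorem two_mul_idealMaxLee_add (hp : p ≠ 2) {e : ℕ} (he : e ≤ s) :
    2 * idealMaxLee p s e + p ^ e = p ^ s := by
  have hpos : 0 < p ^ e := pow_pos (Fact.out : p.Prime).pos e
  obtain ⟨b, hb⟩ := exists_two_mul_add_pow hp he
  suffices h : IsGreatest {w | ∃ x ∈ Ideal.span {(p : ZMod (p ^ s)) ^ e}, leeWt x = w}
      (p ^ e * b) by
    rw [(isGreatest_idealMaxLee p s e).unique h, hb]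
  constructor
  · refine ⟨((p ^ e * b : ℕ) : ZMod (p ^ s)),
      (natCast_mem_span_pow_iff he _).2 (dvd_mul_right _ _), ?_⟩
    rw [leeWt_natCast (by omega)]
    omega
  · rintro w ⟨x, hx, rfl⟩
    -- Two multiples of `p^e` adding up to the odd multiple `p^s` cannot both exceed `M`.
    obtain ⟨c, hc⟩ := (mem_span_pow_iff he x).1 hx
    have hs : p ^ s = p ^ e * (2 * b + 1) := by rw [← hb]; ring
    rw [leeWt, hc, hs, ← Nat.mul_sub, Nat.mul_min_mul_left]
    exact Nat.mul_le_mul_left _ (by omega)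

/-- Each coset of `⟨p^e⟩` contains an element of Lee weight at least `M_e`, and of larger Lee
weight unless the coset is `⟨p^e⟩` itself: the multiples of `p^e` are the coset whose points
lie at distance at least `p^e / 2` from `p^s / 2`. -/
theorem exists_le_leeWt_add (hp : p ≠ 2) {e : ℕ} (he : e ≤ s) (x : ZMod (p ^ s)) :
    ∃ y ∈ Ideal.span {(p : ZMod (p ^ s)) ^ e}, idealMaxLee p s e ≤ leeWt (x + y) ∧
      (x ∉ Ideal.span {(p : ZMod (p ^ s)) ^ e} → idealMaxLee p s e < leeWt (x + y)) := by
  have hpos : 0 < p ^ e := pow_pos (Fact.out : p.Prime).pos e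
  obtain ⟨b, hb⟩ := exists_two_mul_add_pow hp he
  have hM := two_mul_idealMaxLee_add hp he
  have hr := Nat.mod_lt x.val hpos
  set r := x.val % p ^ e with hr_def
  -- `M + r` is the representative of the coset in the window `[M, M + p^e)`.
  have hmem : ((p ^ e * b + r : ℕ) : ZMod (p ^ s)) - x ∈
      Ideal.span {(p : ZMod (p ^ s)) ^ e} := by
    have hx : x = ((r + p ^ e * (x.val / p ^ e) : ℕ) : ZMod (p ^ s)) := by
      rw [hr_def, Nat.mod_add_div, ZMod.natCast_zmod_val]
    rw [Ideal.mem_span_singleton']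
    refine ⟨b - ((x.val / p ^ e : ℕ) : ZMod (p ^ s)), ?_⟩
    conv_rhs => rw [hx]
    push_cast
    ring
  refine ⟨_, hmem, ?_⟩
  rw [add_sub_cancel, leeWt_natCast (by omega), mem_span_pow_iff he, Nat.dvd_iff_mod_eq_zero,
    ← hr_def]
  clear_value r
  clear hr_def
  omega

/-- The ideal `⟨p^e⟩` has two elements of maximal Lee weight that differ by `p^e`. -/
theorem exists_leeWt_eq_idealMaxLee (hp : p ≠ 2) {e : ℕ} (he : e ≤ s) :
    ∃ y ∈ Ideal.span {(p : ZMod (p ^ s)) ^ e},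
      leeWt y = idealMaxLee p s e ∧ leeWt (y + (p : ZMod (p ^ s)) ^ e) = idealMaxLee p s e := by
  have hpos : 0 < p ^ e := pow_pos (Fact.out : p.Prime).pos e
  obtain ⟨b, hb⟩ := exists_two_mul_add_pow hp he
  have hM := two_mul_idealMaxLee_add hp he
  refine ⟨((p ^ e * b : ℕ) : ZMod (p ^ s)),
    (natCast_mem_span_pow_iff he _).2 (dvd_mul_right _ _), ?_, ?_⟩
  · rw [leeWt_natCast (by omega)]
    omega
  · -- For `e = s` the sum wraps around to `0`.
    rcases Nat.eq_zero_or_pos (p ^ e * b) with h0 | h0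
    · have h1 : p ^ e = p ^ s := by omega
      have h2 : (p : ZMod (p ^ s)) ^ e = ((p ^ s : ℕ) : ZMod (p ^ s)) := by
        rw [← h1]
        push_cast
        rfl
      rw [h0, h2, ZMod.natCast_self]
      simp only [Nat.cast_zero, add_zero]
      rw [leeWt, ZMod.val_zero]
      omega
    · rw [← Nat.cast_pow, ← Nat.cast_add, leeWt_natCast (by omega)]
      omega

end LeeWeight

/-! ### Products of ideals -/

section Box

variable {p s n : ℕ}

/-- The code `∏ⱼ ⟨p^(e j)⟩`, a product of ideals of `ℤ/p^s`. -/
def box (p s : ℕ) {n : ℕ} (e : Fin n → ℕ) : Code p s n :=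
  Submodule.pi Set.univ fun j => Ideal.span {(p : ZMod (p ^ s)) ^ e j}

theorem mem_box {e : Fin n → ℕ} {x : Fin n → ZMod (p ^ s)} :
    x ∈ box p s e ↔ ∀ j, x j ∈ Ideal.span {(p : ZMod (p ^ s)) ^ e j} := by
  simp [box, Submodule.mem_pi]

theorem box_inf_box (e f : Fin n → ℕ) :
    box p s e ⊓ box p s f = box p s fun j => max (e j) (f j) := by
  ext x
  simp only [Submodule.mem_inf, mem_box, ← forall_and, ← span_pow_inf_span_pow]

theorem map_permMatrix_box (σ : Equiv.Perm (Fin n)) (e : Fin n → ℕ) :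
    (box p s e).map (σ.permMatrix (ZMod (p ^ s))).vecMulLinear = box p s (e ∘ σ.symm) := by
  ext x
  simp only [Submodule.mem_map, Matrix.vecMulLinear_apply, Matrix.vecMul_permMatrix, mem_box]
  constructor
  · rintro ⟨y, hy, rfl⟩ j
    exact hy (σ.symm j)
  · exact fun h => ⟨x ∘ σ, fun j => by simpa using h (σ j), by ext j; simp⟩

variable [Fact p.Prime]

theorem card_box {e : Fin n → ℕ} (he : ∀ j, e j ≤ s) :
    Nat.card (box p s e) = ∏ j, p ^ (s - e j) := by
  have h : (box p s e : Set (Fin n → ZMod (p ^ s))) = Set.univ.pi fun j =>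
      ((Ideal.span {(p : ZMod (p ^ s)) ^ e j} : Ideal (ZMod (p ^ s))) : Set (ZMod (p ^ s))) := by
    ext x
    simp [mem_box]
  have hcard := Nat.card_congr ((Equiv.setCongr h).trans (Equiv.Set.univPi _))
  rw [Nat.card_pi] at hcard
  exact hcard.trans <| Finset.prod_congr rfl fun j _ => card_span_pow (he j)

theorem mem_box_const_iff (m : ℕ) (x : Fin n → ZMod (p ^ s)) :
    x ∈ box p s (fun _ => s - m) ↔ (p : ZMod (p ^ s)) ^ m • x = 0 := by
  simp only [mem_box, funext_iff, Pi.smul_apply, smul_eq_mul, Pi.zero_apply, pow_mul_eq_zero_iff]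

/-- The `p^m`-torsion of `∏ⱼ ⟨p^(e j)⟩` has `∏ⱼ p^min(m, s - e j)` elements. -/
theorem card_box_inf_const {e : Fin n → ℕ} (he : ∀ j, e j ≤ s) (m : ℕ) :
    Nat.card (box p s e ⊓ box p s (fun _ => s - m) : Code p s n) =
      p ^ ∑ j, min m (s - e j) := by
  rw [box_inf_box, card_box fun j => max_le (he j) (Nat.sub_le s m), ← Finset.prod_pow_eq_pow_sum]
  refine Finset.prod_congr rfl fun j _ => ?_
  have := he j
  congr 1
  omega

/-- The number of `p^m`-torsion elements is an isomorphism invariant of codes. -/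
theorem card_inf_const_congr {n' : ℕ} {C : Code p s n} {D : Code p s n'}
    (φ : C ≃ₗ[ZMod (p ^ s)] D) (m : ℕ) :
    Nat.card (C ⊓ box p s (fun _ => s - m) : Code p s n) =
      Nat.card (D ⊓ box p s (fun _ => s - m) : Code p s n') := by
  have aux {n : ℕ} (C : Code p s n) :
      Nat.card (C ⊓ box p s (fun _ => s - m) : Code p s n) =
        Nat.card {x : C // (p : ZMod (p ^ s)) ^ m • x = 0} := by
    refine Nat.card_congr ⟨fun x => ⟨⟨x, x.2.1⟩, ?_⟩, fun x => ⟨x, x.1.2, ?_⟩,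
      fun _ => rfl, fun _ => rfl⟩
    · exact Subtype.ext ((mem_box_const_iff m _).1 x.2.2)
    · exact (mem_box_const_iff m _).2 (congrArg Subtype.val x.2)
  rw [aux, aux]
  refine Nat.card_congr (φ.toEquiv.subtypeEquiv fun x => ?_)
  change _ ↔ _ • φ x = 0
  rw [← map_smul, map_eq_zero_iff φ φ.injective]

theorem maxLeeWeight_box (e : Fin n → ℕ) :
    maxLeeWeight (box p s e) = ∑ j, idealMaxLee p s (e j) := by
  refine (isGreatest_maxLeeWeight _).unique ⟨?_, ?_⟩
  · choose x hx hw using fun j => (isGreatest_idealMaxLee p s (e j)).1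
    exact ⟨x, mem_box.2 hx, Finset.sum_congr rfl fun j _ => hw j⟩
  · rintro w ⟨x, hx, rfl⟩
    exact Finset.sum_le_sum fun j _ => leeWt_le_idealMaxLee (mem_box.1 hx j)

end Box

/-! ### The block diagonal code -/

section Diagonal

variable {p s n : ℕ} {k : Fin s → ℕ}

/-- The exponents of the columns of `diagMatrix p s n k`: a column in the block `p^i I` has
exponent `i`, and a zero column has exponent `s`. -/
def blockExponent (k : Fin s → ℕ) (n : ℕ) (c : Fin n) : ℕ :=
  if h : (c : ℕ) < ∑ i, k i then ((finSigmaFinEquiv.symm ⟨c, h⟩).1 : ℕ) else s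

theorem blockExponent_le (c : Fin n) : blockExponent k n c ≤ s := by
  unfold blockExponent
  split_ifs
  · exact (finSigmaFinEquiv.symm _).1.2.le
  · rfl

theorem sum_blockExponent (hk : ∑ i, k i ≤ n) (f : ℕ → ℕ) (hf : f s = 0) :
    ∑ c, f (blockExponent k n c) = ∑ i : Fin s, k i * f i := by
  obtain ⟨d, rfl⟩ := Nat.exists_eq_add_of_le hk
  have h1 (c : Fin (∑ i, k i)) : blockExponent k _ (Fin.castAdd d c) =
      ((finSigmaFinEquiv.symm c).1 : ℕ) := by simp [blockExponent]
  have h2 (c : Fin d) : blockExponent k _ (Fin.natAdd (∑ i, k i) c) = s := by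
    simp [blockExponent]
  rw [Fin.sum_univ_add]
  simp only [h1, h2, hf, Finset.sum_const_zero, add_zero]
  rw [Equiv.sum_comp finSigmaFinEquiv.symm fun r => f r.1, Fintype.sum_sigma]
  simp

theorem vecMul_diagMatrix_apply (y : ((i : Fin s) × Fin (k i)) → ZMod (p ^ s)) (c : Fin n) :
    Matrix.vecMul y (diagMatrix p s n k) c = if h : (c : ℕ) < ∑ i, k i then
      y (finSigmaFinEquiv.symm ⟨c, h⟩) * (p : ZMod (p ^ s)) ^ blockExponent k n c else 0 := by
  simp only [Matrix.vecMul, dotProduct, diagMatrix, Matrix.of_apply, mul_ite, mul_zero]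
  split_ifs with h
  · rw [Finset.sum_eq_single (finSigmaFinEquiv.symm ⟨c, h⟩)]
    · simp [blockExponent, h]
    · intro r _ hr
      refine if_neg fun hc => hr ?_
      rw [Equiv.eq_symm_apply]
      exact Fin.ext hc
    · simp
  · refine Finset.sum_eq_zero fun r _ => if_neg fun hc => h ?_
    rw [← hc]
    exact (finSigmaFinEquiv r).2

theorem rowCode_diagMatrix (hk : ∑ i, k i ≤ n) :
    rowCode (diagMatrix p s n k) = box p s (blockExponent k n) := by
  rw [rowCode, ← range_vecMulLinear]
  ext x
  rw [LinearMap.mem_range, mem_box]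
  simp only [Matrix.vecMulLinear_apply, Ideal.mem_span_singleton']
  constructor
  · rintro ⟨y, rfl⟩ c
    rw [vecMul_diagMatrix_apply]
    split_ifs with h
    · exact ⟨_, rfl⟩
    · exact ⟨0, zero_mul _⟩
  · intro hx
    choose a ha using hx
    refine ⟨fun r => a (Fin.castLE hk (finSigmaFinEquiv r)), ?_⟩
    ext c
    rw [vecMul_diagMatrix_apply]
    split_ifs with h
    · simp only [Equiv.apply_symm_apply, Fin.castLE_mk, Fin.eta, ha]
    · rw [← ha c, blockExponent, dif_neg h, natCast_pow_self_eq_zero, mul_zero]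

variable [Fact p.Prime]

theorem hasSubtype_rowCode_diagMatrix (hk : ∑ i, k i ≤ n) :
    HasSubtype (rowCode (diagMatrix p s n k)) k := by
  have hker : LinearMap.ker (diagMatrix p s n k).vecMulLinear = Submodule.pi Set.univ
      fun r : (i : Fin s) × Fin (k i) =>
        Ideal.span {(p : ZMod (p ^ s)) ^ (s - (r.1 : ℕ))} := by
    ext y
    simp only [LinearMap.mem_ker, Matrix.vecMulLinear_apply, Submodule.mem_pi, Set.mem_univ,
      true_imp_iff, ← pow_mul_eq_zero_iff, funext_iff, vecMul_diagMatrix_apply,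
      Pi.zero_apply]
    constructor
    · intro h r
      have hr := h (Fin.castLE hk (finSigmaFinEquiv r))
      have hlt : ((Fin.castLE hk (finSigmaFinEquiv r) : Fin n) : ℕ) < ∑ i, k i :=
        (finSigmaFinEquiv r).2
      rw [dif_pos hlt, blockExponent, dif_pos hlt] at hr
      have hr' : finSigmaFinEquiv.symm
          ⟨(Fin.castLE hk (finSigmaFinEquiv r) : Fin n), hlt⟩ = r :=
        finSigmaFinEquiv.symm_apply_apply r
      rwa [hr', mul_comm] at hr
    · intro h c
      split_ifs with hc
      · rw [blockExponent, dif_pos hc, mul_comm]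
        exact h _
      · rfl
  rw [rowCode, ← range_vecMulLinear]
  exact ⟨(LinearMap.quotKerEquivRange _).symm ≪≫ₗ Submodule.quotEquivOfEq _ _ hker ≪≫ₗ
    Submodule.quotientPi _ ≪≫ₗ LinearEquiv.piCurry (ZMod (p ^ s)) fun (i : Fin s) (_ : Fin (k i)) =>
      ZMod (p ^ s) ⧸ Ideal.span {(p : ZMod (p ^ s)) ^ (s - (i : ℕ))}⟩

/-- A code of subtype `k` has as many `p^m`-torsion elements as the block diagonal code. -/
theorem HasSubtype.card_inf_const {C : Code p s n} (h : HasSubtype C k) (m : ℕ) :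
    Nat.card (C ⊓ box p s (fun _ => s - m) : Code p s n) =
      p ^ ∑ i : Fin s, k i * min m (s - i) := by
  obtain ⟨φ⟩ := h
  obtain ⟨ψ⟩ := hasSubtype_rowCode_diagMatrix (p := p) (le_refl (∑ i, k i))
  rw [card_inf_const_congr (φ ≪≫ₗ ψ.symm), rowCode_diagMatrix le_rfl,
    card_box_inf_const blockExponent_le,
    sum_blockExponent le_rfl (fun e => min m (s - e)) (by simp)]

/-- The block diagonal code is an optimal anticode, and being one is invariant under
permutations of the coordinates. -/
theorem isOptimalLeeAnticode_of_permEquiv {C : Code p s n} (hk : ∑ i, k i ≤ n)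
    (h : PermEquiv C (rowCode (diagMatrix p s n k))) : IsOptimalLeeAnticode C := by
  obtain ⟨σ, hσ⟩ := h
  have hperm (x : Fin n → ZMod (p ^ s)) :
      (σ.permMatrix (ZMod (p ^ s))).vecMulLinear x = x ∘ σ.symm := by
    rw [Matrix.vecMulLinear_apply, Matrix.vecMul_permMatrix]
  have hinj : Function.Injective (σ.permMatrix (ZMod (p ^ s))).vecMulLinear := by
    intro x y hxy
    rw [hperm, hperm] at hxy
    exact σ.symm.surjective.injective_comp_right hxy
  obtain ⟨φ⟩ := hasSubtype_rowCode_diagMatrix (p := p) hk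
  refine ⟨k, ⟨Submodule.equivMapOfInjective _ hinj C ≪≫ₗ LinearEquiv.ofEq _ _ hσ.symm ≪≫ₗ φ⟩, ?_⟩
  have hwt (x : Fin n → ZMod (p ^ s)) :
      leeWeight ((σ.permMatrix (ZMod (p ^ s))).vecMulLinear x) = leeWeight x := by
    rw [hperm]
    exact Equiv.sum_comp σ.symm fun j => leeWt (x j)
  have hmax : maxLeeWeight C = maxLeeWeight (rowCode (diagMatrix p s n k)) := by
    unfold maxLeeWeight
    rw [hσ]
    congr 1
    ext w
    simp only [Set.mem_ofPred_eq, Submodule.mem_map, exists_exists_and_eq_and, hwt]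
  rw [hmax, rowCode_diagMatrix hk, maxLeeWeight_box,
    sum_blockExponent hk (idealMaxLee p s) idealMaxLee_self]

end Diagonal

/-! ### Leading exponents of a code -/

section Leading

variable {p s n : ℕ}

/-- Prepending the coordinate `0` to a vector. -/
def consZero (p s n : ℕ) : (Fin n → ZMod (p ^ s)) →ₗ[ZMod (p ^ s)] (Fin (n + 1) → ZMod (p ^ s)) where
  toFun v := Fin.cons 0 v
  map_add' v w := by ext j; cases j using Fin.cases <;> simp
  map_smul' a v := by ext j; cases j using Fin.cases <;> simp

@[simp]
theorem consZero_zero (v : Fin n → ZMod (p ^ s)) : consZero p s n v 0 = 0 := rfl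

@[simp]
theorem consZero_succ (v : Fin n → ZMod (p ^ s)) (j : Fin n) :
    consZero p s n v j.succ = v j := rfl

/-- `IsLeading C e` says that `⟨p^(e j)⟩` is, for each `j`, the ideal of the `j`-th coordinates
of those codewords of `C` whose coordinates before `j` vanish. It is defined by recursion on the
length: the first coordinates of `C` form `⟨p^(e 0)⟩`, and the remaining exponents belong to the
tail code `{v | (0, v) ∈ C}`. -/
inductive IsLeading : {n : ℕ} → Code p s n → (Fin n → ℕ) → Prop
  | nil (C : Code p s 0) (e : Fin 0 → ℕ) : IsLeading C e
  | cons {n : ℕ} (C : Code p s (n + 1)) (e : Fin (n + 1) → ℕ) (he : e 0 ≤ s)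
      (head : C.map (LinearMap.proj 0) = Ideal.span {(p : ZMod (p ^ s)) ^ e 0})
      (tail : IsLeading (C.comap (consZero p s n)) fun j => e j.succ) : IsLeading C e

theorem IsLeading.le {C : Code p s n} {e : Fin n → ℕ} (h : IsLeading C e) (j : Fin n) :
    e j ≤ s := by
  induction h with
  | nil => exact j.elim0
  | cons C e he _ _ ih => exact Fin.cases he ih j

theorem exists_isLeading [Fact p.Prime] (C : Code p s n) : ∃ e, IsLeading C e := by
  induction n with
  | zero => exact ⟨Fin.elim0, .nil C _⟩
  | succ n ih =>
    obtain ⟨e₀, he₀, h₀⟩ := exists_eq_span_pow (C.map (LinearMap.proj 0) : Ideal (ZMod (p ^ s)))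
    obtain ⟨e, he⟩ := ih (C.comap (consZero p s n))
    exact ⟨Fin.cons e₀ e, .cons C _ he₀ h₀ he⟩

theorem card_eq_card_map_mul_card_comap (C : Code p s (n + 1)) :
    Nat.card C = Nat.card (C.map (LinearMap.proj 0 : (Fin (n + 1) → ZMod (p ^ s)) →ₗ[_] _)) *
      Nat.card (C.comap (consZero p s n)) := by
  set f := (LinearMap.proj 0 : (Fin (n + 1) → ZMod (p ^ s)) →ₗ[ZMod (p ^ s)] _).domRestrict C
  have h1 : LinearMap.range f = C.map (LinearMap.proj 0) := LinearMap.range_domRestrict _ _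
  have e : LinearMap.ker f ≃ C.comap (consZero p s n) :=
    { toFun := fun x => ⟨Fin.tail x.1.1, by
        have h0 : x.1.1 0 = 0 := x.2
        have : consZero p s n (Fin.tail x.1.1) = x.1.1 := by
          ext j
          cases j using Fin.cases with
          | zero => exact h0.symm
          | succ j => rfl
        rw [Submodule.mem_comap, this]
        exact x.1.2⟩
      invFun := fun v => ⟨⟨consZero p s n v, v.2⟩, rfl⟩
      left_inv := fun x => by
        have h0 : x.1.1 0 = 0 := x.2
        ext j
        cases j using Fin.cases with
        | zero => exact h0.symm
        | succ j => rfl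
      right_inv := fun v => rfl }
  rw [Submodule.card_eq_card_quotient_mul_card (LinearMap.ker f),
    Nat.card_congr f.quotKerEquivRange.toEquiv, Nat.card_congr e, h1, mul_comm]

theorem leeWeight_succ (x : Fin (n + 1) → ZMod (p ^ s)) :
    leeWeight x = leeWt (x 0) + leeWeight (Fin.tail x) :=
  Fin.sum_univ_succ _

theorem tail_add_consZero (x : Fin (n + 1) → ZMod (p ^ s)) (v : Fin n → ZMod (p ^ s)) :
    Fin.tail (x + consZero p s n v) = Fin.tail x + v := rfl

variable [Fact p.Prime] {C : Code p s n} {e : Fin n → ℕ}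

theorem IsLeading.card_eq (h : IsLeading C e) : Nat.card C = ∏ j, p ^ (s - e j) := by
  induction h with
  | nil C e => simp
  | cons C e he head _ ih =>
    rw [card_eq_card_map_mul_card_comap, ih, head, card_span_pow he, Fin.prod_univ_succ]

/-- Counting torsion elements is submultiplicative along the flag of coordinates, so `C` has at
most as many of them as the product of its leading ideals. -/
theorem IsLeading.card_inf_const_le (h : IsLeading C e) (m : ℕ) :
    Nat.card (C ⊓ box p s (fun _ => s - m) : Code p s n) ≤ p ^ ∑ j, min m (s - e j) := by
  induction h with
  | nil C e => simp
  | @cons n C e he head _ ih =>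
    have hcomap : (C ⊓ box p s (fun _ => s - m)).comap (consZero p s n) =
        C.comap (consZero p s n) ⊓ box p s (fun _ => s - m) := by
      ext v
      simp [mem_box, Fin.forall_fin_succ]
    have hmap : (C ⊓ box p s (fun _ => s - m)).map
          (LinearMap.proj 0 : (Fin (n + 1) → ZMod (p ^ s)) →ₗ[ZMod (p ^ s)] _) ≤
        Ideal.span {(p : ZMod (p ^ s)) ^ max (e 0) (s - m)} := by
      rw [← span_pow_inf_span_pow, ← head]
      rintro _ ⟨x, hx, rfl⟩
      exact ⟨Submodule.mem_map_of_mem hx.1, mem_box.1 hx.2 0⟩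
    have hcard := Nat.card_mono (Set.toFinite _) (SetLike.coe_subset_coe.2 hmap)
    have hmax : s - max (e 0) (s - m) = min m (s - e 0) := by omega
    rw [card_eq_card_map_mul_card_comap, hcomap, Fin.sum_univ_succ, pow_add]
    refine Nat.mul_le_mul (hcard.trans_eq ?_) ih
    rw [← hmax]
    exact card_span_pow (max_le he (Nat.sub_le s m))

/-- Greedy choice of a heavy word in a coset of a code: the first coordinate is brought to Lee
weight at least `M_(e 0)` by a codeword, and the remaining freedom is the tail code. -/
theorem IsLeading.exists_le_leeWeight_add (hp : p ≠ 2) (h : IsLeading C e)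
    (x : Fin n → ZMod (p ^ s)) :
    ∃ c ∈ C, ∑ j, idealMaxLee p s (e j) ≤ leeWeight (x + c) := by
  induction h with
  | nil C e => exact ⟨0, C.zero_mem, by simp⟩
  | cons C e he head _ ih =>
    obtain ⟨y, hy, hxy, -⟩ := exists_le_leeWt_add hp he (x 0)
    rw [← head] at hy
    obtain ⟨c, hc, rfl⟩ := hy
    obtain ⟨v, hv, hle⟩ := ih (Fin.tail (x + c))
    refine ⟨c + consZero p s _ v, C.add_mem hc hv, ?_⟩
    rw [← add_assoc, leeWeight_succ, Fin.sum_univ_succ, tail_add_consZero]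
    refine Nat.add_le_add ?_ hle
    simpa using hxy

/-- If the greedy bound is sharp on the coset `x + C`, then the coset lies in the product of the
leading ideals. -/
theorem IsLeading.le_box_of_leeWeight_add_le (hp : p ≠ 2) (h : IsLeading C e)
    (x : Fin n → ZMod (p ^ s))
    (hx : ∀ c ∈ C, leeWeight (x + c) ≤ ∑ j, idealMaxLee p s (e j)) :
    x ∈ box p s e ∧ C ≤ box p s e := by
  induction h with
  | nil C e => exact ⟨mem_box.2 fun j => j.elim0, fun _ _ => mem_box.2 fun j => j.elim0⟩
  | @cons n C e he head tail ih =>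
    rw [Fin.sum_univ_succ] at hx
    -- A codeword that makes the first coordinate maximal leaves a sharp coset of the tail code.
    have hsharp : ∀ c ∈ C, idealMaxLee p s (e 0) ≤ leeWt ((x + c) 0) →
        leeWt ((x + c) 0) = idealMaxLee p s (e 0) ∧ Fin.tail (x + c) ∈ box p s (fun j => e j.succ) ∧
          C.comap (consZero p s n) ≤ box p s fun j => e j.succ := by
      intro c hc hle
      have hadd (v : Fin n → ZMod (p ^ s)) (hv : v ∈ C.comap (consZero p s n)) :
          leeWt ((x + c) 0) + leeWeight (Fin.tail (x + c) + v) ≤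
            idealMaxLee p s (e 0) + ∑ j : Fin n, idealMaxLee p s (e j.succ) := by
        have := hx _ (C.add_mem hc hv)
        rw [← add_assoc, leeWeight_succ, tail_add_consZero] at this
        simpa using this
      obtain ⟨v, hv, hle'⟩ := tail.exists_le_leeWeight_add hp (Fin.tail (x + c))
      have hv' := hadd v hv
      refine ⟨by omega, ih _ fun v hv => ?_⟩
      have := hadd v hv
      beta_reduce
      omega
    have hx0 : x 0 ∈ Ideal.span {(p : ZMod (p ^ s)) ^ e 0} := by
      by_contra hx0
      obtain ⟨y, hy, hle, hlt⟩ := exists_le_leeWt_add hp he (x 0)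
      rw [← head] at hy
      obtain ⟨c, hc, rfl⟩ := hy
      exact (hlt hx0).ne' (hsharp c hc hle).1
    -- Two such codewords `c`, `c'` whose first coordinates differ by the generator `p^(e 0)`.
    obtain ⟨y, hy, hy1, hy2⟩ := exists_leeWt_eq_idealMaxLee hp he
    have hc1 : y - x 0 ∈ C.map (LinearMap.proj 0) := by
      rw [head]
      exact Ideal.sub_mem _ hy hx0
    have hc2 : y + (p : ZMod (p ^ s)) ^ e 0 - x 0 ∈ C.map (LinearMap.proj 0) := by
      rw [head]
      exact Ideal.sub_mem _ (Ideal.add_mem _ hy (Ideal.mem_span_singleton_self _)) hx0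
    obtain ⟨c, hc, hc0⟩ := hc1
    obtain ⟨c', hc', hc0'⟩ := hc2
    simp only [LinearMap.proj_apply] at hc0 hc0'
    obtain ⟨-, ht, hC⟩ := hsharp c hc (by simp [hc0, hy1])
    obtain ⟨-, ht', -⟩ := hsharp c' hc' (by simp [hc0', hy2])
    have hg0 : (c' - c) 0 = (p : ZMod (p ^ s)) ^ e 0 := by
      rw [Pi.sub_apply, hc0, hc0']
      ring
    have hg : ∀ j : Fin n, (c' - c) j.succ ∈ Ideal.span {(p : ZMod (p ^ s)) ^ e j.succ} := by
      intro j
      have := Ideal.sub_mem _ (mem_box.1 ht' j) (mem_box.1 ht j)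
      simpa [Fin.tail] using this
    have hCbox : C ≤ box p s e := by
      intro d hd
      have hd0 : d 0 ∈ Ideal.span {(p : ZMod (p ^ s)) ^ e 0} := by
        rw [← head]
        exact Submodule.mem_map_of_mem hd
      obtain ⟨a, ha⟩ := Ideal.mem_span_singleton'.1 hd0
      have hdz : consZero p s n (Fin.tail (d - a • (c' - c))) = d - a • (c' - c) := by
        ext j
        cases j using Fin.cases with
        | zero => rw [Pi.sub_apply, Pi.smul_apply, hg0, smul_eq_mul, ha, sub_self]; rfl
        | succ j => rfl
      have hd' := hC (x := Fin.tail (d - a • (c' - c))) (by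
        rw [Submodule.mem_comap, hdz]
        exact C.sub_mem hd (C.smul_mem a (C.sub_mem hc' hc)))
      refine mem_box.2 fun j => ?_
      cases j using Fin.cases with
      | zero => exact hd0
      | succ j =>
        have := Ideal.add_mem _ (mem_box.1 hd' j) (Ideal.mul_mem_left _ a (hg j))
        simpa [Fin.tail] using this
    refine ⟨mem_box.2 fun j => ?_, hCbox⟩
    cases j using Fin.cases with
    | zero => exact hx0
    | succ j =>
      have := Ideal.sub_mem _ (mem_box.1 ht j) (mem_box.1 (hCbox hc) j.succ)
      simpa [Fin.tail] using this

end Leading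

/-! ### Comparison of exponents by their truncations -/

/-- The function `ℓ ↦ p^s - p^(s - ℓ)` is a nonnegative combination of the truncations
`ℓ ↦ min m ℓ`, because with truncated subtraction it is increasing and concave on `ℕ` and
vanishes at `0`. -/
theorem exists_pow_eq_pow_sub_add_sum_min {p : ℕ} (hp : 0 < p) (s : ℕ) :
    ∃ c : ℕ → ℕ, ∀ l, p ^ s = p ^ (s - l) + ∑ m ∈ Finset.range (s + 1), c m * min m l := by
  obtain ⟨q, rfl⟩ : ∃ q, p = q + 1 := ⟨p - 1, by omega⟩
  -- The coefficient of `min s ℓ` has to be known for the induction.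
  suffices h : ∃ c : ℕ → ℕ, ∀ l, (q + 1) ^ s =
      (q + 1) ^ (s - l) + (∑ m ∈ Finset.range s, c m * min m l + q * min s l) by
    obtain ⟨c, hc⟩ := h
    refine ⟨fun m => if m < s then c m else q, fun l => (hc l).trans ?_⟩
    rw [Finset.sum_range_succ]
    simp only [lt_irrefl, if_false]
    congr 2
    exact Finset.sum_congr rfl fun m hm => by rw [if_pos (Finset.mem_range.1 hm)]
  induction s with
  | zero => exact ⟨0, by simp⟩
  | succ s ih =>
    obtain ⟨c, hc⟩ := ih
    refine ⟨fun m => if m < s then (q + 1) * c m else q ^ 2, fun l => ?_⟩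
    have hsum : ∑ m ∈ Finset.range s, (if m < s then (q + 1) * c m else q ^ 2) * min m l =
        (q + 1) * ∑ m ∈ Finset.range s, c m * min m l := by
      rw [Finset.mul_sum]
      exact Finset.sum_congr rfl fun m hm => by rw [if_pos (Finset.mem_range.1 hm), mul_assoc]
    rw [Finset.sum_range_succ, hsum, pow_succ, hc l]
    simp only [lt_irrefl, if_false]
    rcases le_or_gt l s with hl | hl
    · rw [min_eq_right hl, min_eq_right (hl.trans s.le_succ), Nat.succ_sub hl, pow_succ]
      ring
    · rw [min_eq_left hl.le, min_eq_left hl, Nat.sub_eq_zero_of_le hl.le,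
        Nat.sub_eq_zero_of_le hl]
      ring

theorem sum_idealMaxLee_le {p s n k : ℕ} [Fact p.Prime] (hp : p ≠ 2) {e : Fin n → ℕ}
    {f : Fin k → ℕ} (he : ∀ j, e j ≤ s) (hf : ∀ j, f j ≤ s)
    (h : ∀ m, ∑ j, min m (s - f j) ≤ ∑ j, min m (s - e j)) :
    ∑ j, idealMaxLee p s (f j) ≤ ∑ j, idealMaxLee p s (e j) := by
  obtain ⟨c, hc⟩ := exists_pow_eq_pow_sub_add_sum_min (Fact.out : p.Prime).pos s
  have key {k : ℕ} {f : Fin k → ℕ} (hf : ∀ j, f j ≤ s) : 2 * ∑ j, idealMaxLee p s (f j) =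
      ∑ m ∈ Finset.range (s + 1), c m * ∑ j, min m (s - f j) := by
    simp only [Finset.mul_sum]
    rw [Finset.sum_comm]
    refine Finset.sum_congr rfl fun j _ => ?_
    have h1 := hc (s - f j)
    have h2 := two_mul_idealMaxLee_add hp (hf j)
    rw [Nat.sub_sub_self (hf j)] at h1
    omega
  have : 2 * ∑ j, idealMaxLee p s (f j) ≤ 2 * ∑ j, idealMaxLee p s (e j) := by
    rw [key he, key hf]
    exact Finset.sum_le_sum fun m _ => Nat.mul_le_mul_left _ (h m)
  omega

/-- Two families with the same truncated sums agree up to a permutation: the number of entries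
equal to `m > 0` is a second difference of the truncated sums. -/
theorem exists_perm_of_sum_min_eq {n : ℕ} {a b : Fin n → ℕ}
    (h : ∀ m, ∑ j, min m (a j) = ∑ j, min m (b j)) : ∃ σ : Equiv.Perm (Fin n), a = b ∘ σ := by
  have hfib (m : ℕ) : Fintype.card {j // a j = m} = Fintype.card {j // b j = m} := by
    simp only [Fintype.card_subtype, Finset.card_filter]
    rcases Nat.eq_zero_or_pos m with rfl | hm
    · have key (a : Fin n → ℕ) : (∑ j, if a j = 0 then 1 else 0) + ∑ j, min 1 (a j) = n := by
        rw [← Finset.sum_add_distrib, Finset.sum_congr rfl (g := fun _ => 1)]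
        · simp
        · intro j _
          split_ifs <;> omega
      have ha := key a
      have hb := key b
      rw [h 1] at ha
      omega
    · have key (a : Fin n → ℕ) : (∑ j, if a j = m then 1 else 0) +
          (∑ j, min (m - 1) (a j) + ∑ j, min (m + 1) (a j)) = 2 * ∑ j, min m (a j) := by
        rw [← Finset.sum_add_distrib, ← Finset.sum_add_distrib, Finset.mul_sum]
        refine Finset.sum_congr rfl fun j _ => ?_
        split_ifs <;> omega
      have ha := key a
      have hb := key b
      rw [h, h, h] at ha
      omega
  exact ⟨Equiv.ofFiberEquiv fun m => Fintype.equivOfCardEq (hfib m),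
    funext fun j => (Equiv.ofFiberEquiv_map _ j).symm⟩

/-! ### Optimal anticodes -/

section Optimal

variable {p s n : ℕ} [Fact p.Prime] {C : Code p s n}

theorem IsOptimalLeeAnticode.exists_eq_box (hp : p ≠ 2) (h : IsOptimalLeeAnticode C) :
    ∃ e : Fin n → ℕ, (∀ j, e j ≤ s) ∧ C = box p s e := by
  obtain ⟨k, hk, hmax⟩ := h
  obtain ⟨e, he⟩ := exists_isLeading C
  refine ⟨e, he.le, ?_⟩
  have hle : maxLeeWeight C ≤ ∑ j, idealMaxLee p s (e j) := by
    rw [hmax, ← sum_blockExponent (le_refl (∑ i, k i)) (idealMaxLee p s) idealMaxLee_self]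
    refine sum_idealMaxLee_le hp he.le blockExponent_le fun m => ?_
    rw [sum_blockExponent le_rfl (fun e => min m (s - e)) (by simp),
      ← Nat.pow_le_pow_iff_right (Fact.out : p.Prime).one_lt, ← hk.card_inf_const]
    exact he.card_inf_const_le m
  have hbox := (he.le_box_of_leeWeight_add_le hp 0 fun c hc => by
    rw [zero_add]
    exact ((isGreatest_maxLeeWeight C).2 ⟨c, hc, rfl⟩).trans hle).2
  refine SetLike.coe_injective (Set.eq_of_subset_of_ncard_le hbox ?_)
  exact ((card_box he.le).trans he.card_eq.symm).le

theorem permEquiv_of_hasSubtype_box {k : Fin s → ℕ} {e : Fin n → ℕ} (he : ∀ j, e j ≤ s)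
    (h : HasSubtype (box p s e) k) :
    ∑ i, k i ≤ n ∧ PermEquiv (box p s e) (rowCode (diagMatrix p s n k)) := by
  have hmin (m : ℕ) : ∑ j, min m (s - e j) = ∑ i : Fin s, k i * min m (s - i) := by
    apply Nat.pow_right_injective (Fact.out : p.Prime).two_le
    change p ^ _ = p ^ _
    rw [← h.card_inf_const, card_box_inf_const he]
  have hk : ∑ i, k i ≤ n := by
    calc ∑ i, k i = ∑ i : Fin s, k i * min 1 (s - i) :=
          Finset.sum_congr rfl fun i _ => by rw [min_eq_left (by omega), mul_one]
      _ = ∑ j, min 1 (s - e j) := (hmin 1).symm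
      _ ≤ ∑ _ : Fin n, 1 := Finset.sum_le_sum fun j _ => min_le_left _ _
      _ = n := by simp
  refine ⟨hk, ?_⟩
  obtain ⟨σ, hσ⟩ := exists_perm_of_sum_min_eq (a := fun j => s - e j)
    (b := fun c => s - blockExponent k n c) fun m => by
      rw [hmin, sum_blockExponent hk (fun e => min m (s - e)) (by simp)]
  refine ⟨σ, ?_⟩
  rw [map_permMatrix_box, rowCode_diagMatrix hk]
  congr 1
  ext c
  have h1 := congrFun hσ (σ.symm c)
  have h2 := he (σ.symm c)
  have h3 : blockExponent k n c ≤ s := blockExponent_le c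
  simp only [Function.comp_apply, Equiv.apply_symm_apply] at h1 ⊢
  omega

end Optimal

end LeeCode

theorem mainTheorem2 (p s n : ℕ) [Fact p.Prime] (hs : 0 < s) (k : Fin s → ℕ)
    (C : LeeCode.Code p s n) :
    (∑ i, k i ≤ n → LeeCode.PermEquiv C (LeeCode.rowCode (LeeCode.diagMatrix p s n k)) →
      LeeCode.IsOptimalLeeAnticode C) ∧
    (p ≠ 2 → LeeCode.IsOptimalLeeAnticode C → LeeCode.HasSubtype C k →
      ∑ i, k i ≤ n ∧ LeeCode.PermEquiv C (LeeCode.rowCode (LeeCode.diagMatrix p s n k))) := by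
  refine ⟨LeeCode.isOptimalLeeAnticode_of_permEquiv, fun hp hC hk => ?_⟩
  obtain ⟨e, he, rfl⟩ := hC.exists_eq_box hp
  exact LeeCode.permEquiv_of_hasSubtype_box he hk
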